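/- **Lemma (condition C2 on sets with polynomial decay).** Let $d,m,r\ge 0$ be integers and let $|\cdot|$ be a norm on $\mathbb Z^d$ (subadditive, even, zero only at $0$) with $|(k_1,\dots,k_d)|\ge |k_j|$ for all $j$. For unknowns $a=(a_k)_{k\in\mathbb Z^d}$, $a_k\in\mathbb C^m$ (treated as independent, no reality condition being imposed), consider the ladder of equations $$\frac{da_k}{dt}=F_k(a):=-\lambda_k a_k+N_k(a),\qquad k\in\mathbb Z^d,$$ where $N=N(u,Du,\dots,D^ru)$ is a $\mathbb C^m$-valued polynomial with complex coefficients in the partial derivatives of order at most $r$ of $u=(u_1,\dots,u_m)$, and $N_k(a)$ is the $k$-th Fourier coefficient of $N(u,Du,\dots,D^ru)$ for $u(x)=\sum_k a_ke^{ik\cdot x}$, i.e. the linear combination, over the monomials of $N$, of the convolution sums $\sum_{k_1+\dots+k_l=k}v^{(1)}_{k_1}\cdots v^{(l)}_{k_l}$, with $v_k=i^{|\alpha|}k^\alpha a_{k,j}$ for a factor $v=D^\alpha u_j$. Assume that $\lambda_k\in\mathbb R$ and that there are real constants $p>r$, $K$, $L_*>0$, $L^*$ with $$L_*|k|^p\le\lambda_k\le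 L^*|k|^p\qquad\text{for all }|k|>K .$$ Write the system in the real coordinates indexed by $I=\mathbb Z^d\times\{1,\dots,m\}\times\{0,1\}$ (real and imaginary parts of the components of the $a_k$). Let $H$ be one of the real sequence spaces $c_0(I)$, $l_1(I)$, $l_2(I)$ with its usual norm, let $J_0\subset J_1\subset\cdots$ be non-empty finite subsets of $I$ with $\bigcup_n J_n=I$ (a Galerkin filtration), let $P_n$ be the projection onto the coordinates in $J_n$, and let $F^n=P_n\circ F|_{P_nH}:P_nH\to P_nH$. Let $C\in\mathbb R$, let $$s>2r+d,\qquad W=W_P(C,s)=\Big\{a:\ |a_k|\le \frac{C}{|k|^s}\ (k\ne0),\ |a_0|\le C\Big\},$$ where $|a_k|$ is the Euclidean norm on $\mathbb C^m$. Then $F$ satisfies condition **C2** on $W$: one has $W\subset H$, every $F^n$ is of class $C^1$, and there is $l\in\mathbb R$ such that $$\mu\big(DF^n(P_nz)\big)\le l\qquad\text{for all } n\ge 0\text{ and all } z\in W,$$ where $\mu(A)=\lim_{h\to0^+}\frac{\|I+hA\|-1}{h}$ (the limit exists) is the logarithmic norm of a linear map $A:P_nH\to P_nH$ with respect to the norm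 of $H$; that is, $\mu=\mu_\infty,\mu_1,\mu_2$ for $H=c_0,l_1,l_2$ respectively. -/

import Mathlib

open Filter Topology
open scoped ENNReal

noncomputable section

namespace TorusPDE

/-- Index set of the real unknowns: `(k, j, false)` is the real part and `(k, j, true)` the imaginary
part of the `j`-th component of the Fourier coefficient with wave vector `k ∈ ℤ^d`. -/
abbrev Mode (d m : ℕ) : Type := (Fin d → ℤ) × Fin m × Bool

/-- The `j`-th component of the Fourier coefficient `a_k ∈ ℂ^m`. -/
def coef {d m : ℕ} (a : Mode d m → ℝ) (k : Fin d → ℤ) (j : Fin m) : ℂ :=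
  ⟨a (k, j, false), a (k, j, true)⟩

/-- The arguments of the nonlinearity: the pair `(α, j)` stands for the partial derivative
`D^α u_j`, where `α` is a multi-index with `|α| ≤ r`. -/
abbrev JetVar (d m r : ℕ) : Type := {α : Fin d → Fin (r + 1) // ∑ i, (α i : ℕ) ≤ r} × Fin m

/-- The `k`-th Fourier coefficient `i^{|α|} k^α a_{k,j}` of `D^α u_j`. -/
def jetCoef {d m r : ℕ} (a : Mode d m → ℝ) (v : JetVar d m r) (k : Fin d → ℤ) : ℂ :=
  (∏ i, (Complex.I * (k i : ℂ)) ^ (v.1.1 i : ℕ)) * coef a k v.2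

/-- The `k`-th Fourier coefficient of the monomial `∏ v, v ^ σ v` in the derivatives of `u`:
the sum over all `k_1 + ⋯ + k_l = k` (one wave vector for each of the `l` factors)
of the products of the coefficients of the factors. -/
def monomialCoef {d m r : ℕ} (σ : JetVar d m r →₀ ℕ) (a : Mode d m → ℝ) (k : Fin d → ℤ) : ℂ :=
  ∑' κ : {κ : (Σ v : JetVar d m r, Fin (σ v)) → (Fin d → ℤ) // ∑ i, κ i = k},
    ∏ i, jetCoef a i.1 (κ.1 i)

/-- The `k`-th Fourier coefficient `P_k(a)` of `P(u, Du, …, D^r u)`, `P` a polynomial. -/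
def polyCoef {d m r : ℕ} (P : MvPolynomial (JetVar d m r) ℂ) (a : Mode d m → ℝ)
    (k : Fin d → ℤ) : ℂ :=
  ∑ σ ∈ P.support, P.coeff σ * monomialCoef σ a k

/-- The vector field `F_k(a) = -λ_k a_k + N_k(a)`, written in real coordinates. -/
def vectorField {d m r : ℕ} (lam : (Fin d → ℤ) → ℝ)
    (N : Fin m → MvPolynomial (JetVar d m r) ℂ) (a : Mode d m → ℝ) : Mode d m → ℝ
  | (k, j, false) => (-(lam k : ℂ) * coef a k j + polyCoef (N j) a k).re
  | (k, j, true) => (-(lam k : ℂ) * coef a k j + polyCoef (N j) a k).im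

/-- The set with polynomial decay `W_P(C, s)`: `|a_k| ≤ C / |k|^s` for `k ≠ 0` and `|a_0| ≤ C`,
with the Euclidean norm of `a_k ∈ ℂ^m`. -/
def polyDecaySet {d m : ℕ} (ν : AddGroupNorm (Fin d → ℤ)) (C s : ℝ) : Set (Mode d m → ℝ) :=
  {a | (∀ k, k ≠ 0 → ‖WithLp.toLp 2 (coef a k)‖ ≤ C / ν k ^ s) ∧
    ‖WithLp.toLp 2 (coef a 0)‖ ≤ C}

/-- The three sequence spaces under consideration. -/
inductive SeqSpace where
  | c0 : SeqSpace
  | l1 : SeqSpace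
  | l2 : SeqSpace

/-- The real sequences belonging to the space. -/
def SeqSpace.carrier {ι : Type} : SeqSpace → Set (ι → ℝ)
  | .c0 => {a | Tendsto a cofinite (𝓝 0)}
  | .l1 => {a | Memℓp a 1}
  | .l2 => {a | Memℓp a 2}

/-- The norm of `c0`, `l1`, `l2` is the `ℓ^q` norm with `q = ∞, 1, 2`. -/
def SeqSpace.exponent : SeqSpace → ℝ≥0∞
  | .c0 => ∞
  | .l1 => 1
  | .l2 => 2

instance SeqSpace.fact_one_le (H : SeqSpace) : Fact (1 ≤ H.exponent) :=
  ⟨by cases H <;> simp [SeqSpace.exponent]⟩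

/-- A Galerkin filtration: an increasing sequence of finite sets of indices exhausting
the whole index set. -/
structure GalerkinFiltration (ι : Type) where
  sets : ℕ → Finset ι
  nonempty : ∀ n, (sets n).Nonempty
  mono : Monotone sets
  exhaust : ∀ i, ∃ n, i ∈ sets n

/-- The finite dimensional space `P_n H`, with the norm inherited from `H`. -/
abbrev GalerkinSpace {ι : Type} (H : SeqSpace) (S : Finset ι) : Type :=
  PiLp H.exponent (fun _ : S => ℝ)

/-- The projection `P_n`, which keeps the coordinates in `S`. -/
def proj {ι : Type} (H : SeqSpace) (S : Finset ι) (z : ι → ℝ) : GalerkinSpace H S :=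
  WithLp.toLp _ (fun i : S => z i)

open Classical in
/-- The inclusion of `P_n H` into the space of sequences (extension by zero). -/
def embed {ι : Type} (H : SeqSpace) (S : Finset ι) (y : GalerkinSpace H S) : ι → ℝ :=
  fun i => if h : i ∈ S then y ⟨i, h⟩ else 0

/-- The Galerkin projection `F^n = P_n ∘ F` restricted to `P_n H`. -/
def galerkin {ι : Type} (H : SeqSpace) (S : Finset ι) (F : (ι → ℝ) → (ι → ℝ)) :
    GalerkinSpace H S → GalerkinSpace H S :=
  fun y => proj H S (F (embed H S y))

/-- `μ` is the logarithmic norm of `A`: `μ = lim_{h → 0+} (‖I + h A‖ - 1) / h`. -/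
def IsLogNorm {E : Type} [NormedAddCommGroup E] [NormedSpace ℝ E] (A : E →L[ℝ] E) (μ : ℝ) :
    Prop :=
  Tendsto (fun h : ℝ => (‖ContinuousLinearMap.id ℝ E + h • A‖ - 1) / h) (𝓝[>] 0) (𝓝 μ)

/-- Condition C2 for `F` on `W ⊆ H`: all Galerkin projections `F^n` are of class `C^1`, and there
is a common upper bound for the logarithmic norms (with respect to the norm of `H`) of the
Jacobians `DF^n(P_n z)`, over all `n` and all `z ∈ W`. -/
def ConditionC2 {ι : Type} (H : SeqSpace) (J : GalerkinFiltration ι) (F : (ι → ℝ) → (ι → ℝ))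
    (W : Set (ι → ℝ)) : Prop :=
  W ⊆ H.carrier ∧
  (∀ n, ContDiff ℝ 1 (galerkin H (J.sets n) F)) ∧
  ∃ l : ℝ, ∀ n, ∀ z ∈ W, ∃ μ : ℝ,
    IsLogNorm (fderiv ℝ (galerkin H (J.sets n) F) (proj H (J.sets n) z)) μ ∧ μ ≤ l

end TorusPDE

end

namespace TorusPDE

/-! The Jacobian of `F^n` is the diagonal `-λ_k` plus a compression of `DN`. If the absolute row and
column sums of `DN` at `k` are at most `c (1 + |k|)^r`, with `c` independent of `n` and `z`, then
for small `h` those of `I + hA` are at most `1 + h (c (1 + |k|)^r - λ_k) ≤ 1 + h l`. Here `l` is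
finite because `λ_k` grows like `|k|^p` with `p > r` (`exists_mul_pow_sub_le`). The Schur test turns
this into `‖I + hA‖ ≤ 1 + h l` in all three norms at once.

The bound on `DN` is a convolution estimate. With `w = 1 + |·|`, differentiating one factor of a
monomial with respect to `a_q` costs `w(q)^r`; the other factors are bounded by `g ~ w^(r-s)`. In a
column `w(q)^r` is already the wanted factor; in a row, submultiplicativity of `w` trades it for
`w(k)^r` and an extra `w^r` on each other factor. This needs `∑ w^r g ~ ∑ w^(2r-s) < ∞`, that is `s
> 2r + d`. -/

/-! ### Logarithmic norms and the Schur test -/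

theorem exists_isLogNorm_le {E : Type} [NormedAddCommGroup E] [NormedSpace ℝ E] [Nontrivial E]
    (A : E →L[ℝ] E) (l : ℝ)
    (hl : ∀ᶠ h in 𝓝[>] (0 : ℝ), ‖ContinuousLinearMap.id ℝ E + h • A‖ ≤ 1 + h * l) :
    ∃ μ, IsLogNorm A μ ∧ μ ≤ l := by
  set f : ℝ → ℝ := fun h => (‖ContinuousLinearMap.id ℝ E + h • A‖ - 1) / h with hf
  have hmono : MonotoneOn f (Set.Ioi 0) := by
    intro x hx y hy hxy
    have hx : 0 < x := hx
    have hy : 0 < y := hy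
    -- Convexity of the norm along `I + hA`, with `‖I‖ = 1`, makes the difference quotient
    -- nondecreasing in `h`; being bounded below, it converges to its infimum.
    have h1 : ContinuousLinearMap.id ℝ E + x • A
        = (1 - x / y) • ContinuousLinearMap.id ℝ E
          + (x / y) • (ContinuousLinearMap.id ℝ E + y • A) := by
      rw [smul_add, smul_smul, div_mul_cancel₀ _ hy.ne', sub_smul, one_smul]
      abel
    have hxy1 : x / y ≤ 1 := (div_le_one hy).2 hxy
    have h2 : ‖ContinuousLinearMap.id ℝ E + x • A‖
        ≤ (1 - x / y) + (x / y) * ‖ContinuousLinearMap.id ℝ E + y • A‖ := by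
      rw [h1]
      refine (norm_add_le _ _).trans ?_
      rw [norm_smul, norm_smul, ContinuousLinearMap.norm_id, Real.norm_of_nonneg (by linarith),
        Real.norm_of_nonneg (by positivity), mul_one]
    simp only [hf]
    rw [div_le_div_iff₀ hx hy]
    have h3 := mul_le_mul_of_nonneg_right h2 hy.le
    have h4 : ((1 - x / y) + (x / y) * ‖ContinuousLinearMap.id ℝ E + y • A‖) * y
      = y - x + x * ‖ContinuousLinearMap.id ℝ E + y • A‖ := by field_simp
    linarith
  have hbdd : BddBelow (f '' Set.Ioi 0) := by
    refine ⟨-‖A‖, ?_⟩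
    rintro _ ⟨h, hh, rfl⟩
    have hh : 0 < h := hh
    simp only [hf]
    rw [le_div_iff₀ hh]
    have h1 : ‖ContinuousLinearMap.id ℝ E‖
        ≤ ‖ContinuousLinearMap.id ℝ E + h • A‖ + ‖h • A‖ := by
      simpa using norm_sub_le (ContinuousLinearMap.id ℝ E + h • A) (h • A)
    rw [ContinuousLinearMap.norm_id, norm_smul, Real.norm_of_nonneg hh.le] at h1
    linarith
  have hlim : Tendsto f (𝓝[>] 0) (𝓝 (sInf (f '' Set.Ioi 0))) := hmono.tendsto_nhdsGT hbdd
  refine ⟨_, hlim, le_of_tendsto hlim ?_⟩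
  filter_upwards [hl, self_mem_nhdsWithin] with h hh hpos
  have hpos : 0 < h := hpos
  simp only [hf]
  rw [div_le_iff₀ hpos]
  linarith

/-- **Schur test** for the `ℓ^∞`, `ℓ^1` and `ℓ^2` norms. -/
theorem norm_le_of_row_col_sums {ι : Type} [Fintype ι] (H : SeqSpace)
    (M : PiLp H.exponent (fun _ : ι => ℝ) →L[ℝ] PiLp H.exponent (fun _ : ι => ℝ))
    (e : ι → ι → ℝ) (hM : ∀ x i, M x i = ∑ j, e i j * x j) {R : ℝ} (hR : 0 ≤ R)
    (hrow : ∀ i, ∑ j, |e i j| ≤ R) (hcol : ∀ j, ∑ i, |e i j| ≤ R) : ‖M‖ ≤ R := by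
  refine M.opNorm_le_bound hR fun x => ?_
  have habs : ∀ i, |M x i| ≤ ∑ j, |e i j| * |x j| := fun i => by
    rw [hM]
    refine (Finset.abs_sum_le_sum_abs _ _).trans_eq ?_
    simp [abs_mul]
  cases H with
  | c0 =>
    have hx : ∀ j, |x j| ≤ ‖x‖ := fun j => PiLp.norm_apply_le (p := ∞) x j
    have h1 : ‖M x‖ = ⨆ i, ‖M x i‖ := PiLp.norm_eq_ciSup (M x)
    rw [h1]
    refine Real.iSup_le (fun i => ?_) (by positivity)
    refine (habs i).trans ?_
    calc ∑ j, |e i j| * |x j| ≤ ∑ j, |e i j| * ‖x‖ := by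
          gcongr with j
          exact hx j
      _ = (∑ j, |e i j|) * ‖x‖ := by rw [Finset.sum_mul]
      _ ≤ R * ‖x‖ := by gcongr; exact hrow i
  | l1 =>
    have h1 : ∀ y : PiLp SeqSpace.l1.exponent (fun _ : ι => ℝ), ‖y‖ = ∑ i, |y i| := fun y =>
      PiLp.norm_eq_of_L1 y
    rw [h1, h1]
    calc ∑ i, |M x i| ≤ ∑ i, ∑ j, |e i j| * |x j| := Finset.sum_le_sum fun i _ => habs i
      _ = ∑ j, (∑ i, |e i j|) * |x j| := by rw [Finset.sum_comm]; simp_rw [Finset.sum_mul]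
      _ ≤ ∑ j, R * |x j| := by gcongr with j; exact hcol j
      _ = R * ∑ j, |x j| := by rw [Finset.mul_sum]
  | l2 =>
    have h1 : ∀ y : PiLp SeqSpace.l2.exponent (fun _ : ι => ℝ), ‖y‖ ^ 2 = ∑ i, |y i| ^ 2 := fun y =>
      PiLp.norm_sq_eq_of_L2 _ y
    refine le_of_sq_le_sq ?_ (by positivity)
    rw [mul_pow, h1, h1]
    -- Cauchy–Schwarz with the splitting `|e| |x| = |e|^(1/2) · |e|^(1/2) |x|`: rows are used here,
    -- columns after summing over `i`.
    have h2 : ∀ i, |M x i| ^ 2 ≤ R * ∑ j, |e i j| * |x j| ^ 2 := fun i => by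
      calc |M x i| ^ 2 ≤ (∑ j, |e i j| * |x j|) ^ 2 := by gcongr; exact habs i
        _ ≤ (∑ j, |e i j|) * ∑ j, |e i j| * |x j| ^ 2 := by
          refine Finset.sum_sq_le_sum_mul_sum_of_sq_le_mul _ (fun _ _ => by positivity)
            (fun _ _ => by positivity) (fun _ _ => le_of_eq (by ring))
        _ ≤ _ := by gcongr; exact hrow i
    calc ∑ i, |M x i| ^ 2 ≤ ∑ i, R * ∑ j, |e i j| * |x j| ^ 2 := Finset.sum_le_sum fun i _ => h2 i
      _ = R * ∑ j, (∑ i, |e i j|) * |x j| ^ 2 := by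
        rw [← Finset.mul_sum, Finset.sum_comm]; simp_rw [Finset.sum_mul]
      _ ≤ R * ∑ j, R * |x j| ^ 2 := by gcongr with j; exact hcol j
      _ = R ^ 2 * ∑ j, |x j| ^ 2 := by rw [← Finset.mul_sum]; ring

/-! ### Lattice sums and polynomial decay -/

theorem summable_one_add_abs_int_rpow {t : ℝ} (ht : 1 < t) :
    Summable fun n : ℤ => (1 + |(n : ℝ)|) ^ (-t) := by
  refine (Real.summable_abs_int_rpow ht).of_norm_bounded_eventually ?_
  -- The comparison with `|n|^(-t)` fails only at `n = 0`, where that power is `0` by convention.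
  refine (Set.finite_singleton (0 : ℤ)).subset fun n hn => ?_
  by_contra h0
  apply hn
  have h0 : (n : ℝ) ≠ 0 := by exact_mod_cast h0
  change ‖(1 + |(n : ℝ)|) ^ (-t)‖ ≤ |(n : ℝ)| ^ (-t)
  rw [Real.norm_of_nonneg (by positivity)]
  exact Real.rpow_le_rpow_of_nonpos (abs_pos.2 h0) (by linarith) (by linarith)

theorem summable_prod_comp_apply {κ : Type} {n : ℕ} {f : κ → ℝ} (hf : Summable f)
    (h0 : ∀ x, 0 ≤ f x) : Summable fun k : Fin n → κ => ∏ i, f (k i) := by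
  classical
  refine summable_of_sum_le (c := (∑' x, f x) ^ n)
    (fun k => Finset.prod_nonneg fun i _ => h0 _) fun u => ?_
  have hu : u ⊆ Fintype.piFinset fun i => u.image (fun k => k i) := fun k hk =>
    Fintype.mem_piFinset.2 fun i => Finset.mem_image_of_mem _ hk
  refine (Finset.sum_le_sum_of_subset_of_nonneg hu
    fun k _ _ => Finset.prod_nonneg fun i _ => h0 _).trans ?_
  rw [← Finset.prod_univ_sum]
  refine (Finset.prod_le_prod (fun i _ => Finset.sum_nonneg fun _ _ => h0 _)
    fun i _ => hf.sum_le_tsum _ fun _ _ => h0 _).trans_eq ?_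
  simp

section Weight

variable {d : ℕ} (ν : AddGroupNorm (Fin d → ℤ))

/-- Since `|k|` dominates every `|k_i|`, the weight is at most a product of one-dimensional weights
with exponent `t/d > 1`. For `d = 0` any exponent above `1` serves. -/
theorem summable_one_add_norm_rpow (hν : ∀ (k : Fin d → ℤ) (i : Fin d), |(k i : ℝ)| ≤ ν k)
    {t : ℝ} (ht : (d : ℝ) < t) : Summable fun k : Fin d → ℤ => (1 + ν k) ^ (-t) := by
  have ⟨t', ht', hdt⟩ : ∃ t' : ℝ, 1 < t' ∧ d * t' ≤ t := by
    rcases Nat.eq_zero_or_pos d with rfl | hd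
    · exact ⟨2, one_lt_two, by simpa using ht.le⟩
    · have hd' : (0 : ℝ) < d := by exact_mod_cast hd
      exact ⟨t / d, (one_lt_div hd').2 ht, by field_simp; rfl⟩
  have hw : ∀ k, 1 ≤ 1 + ν k := fun k => by have := apply_nonneg ν k; linarith
  refine (summable_prod_comp_apply (n := d) (summable_one_add_abs_int_rpow ht')
    fun _ => by positivity).of_nonneg_of_le
      (fun k => Real.rpow_nonneg (zero_le_one.trans (hw k)) _) fun k => ?_
  calc (1 + ν k) ^ (-t) ≤ (1 + ν k) ^ (d * (-t')) :=
        Real.rpow_le_rpow_of_exponent_le (hw k) (by linarith)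
    _ = ∏ _i : Fin d, (1 + ν k) ^ (-t') := by
        rw [mul_comm, Real.rpow_mul_natCast (zero_le_one.trans (hw k))]
        simp
    _ ≤ ∏ i, (1 + |(k i : ℝ)|) ^ (-t') := by
        refine Finset.prod_le_prod (fun _ _ => Real.rpow_nonneg (zero_le_one.trans (hw k)) _)
          fun i _ => Real.rpow_le_rpow_of_nonpos (by positivity) ?_ (by linarith)
        have := hν k i
        linarith

theorem finite_setOf_norm_le (hν : ∀ (k : Fin d → ℤ) (i : Fin d), |(k i : ℝ)| ≤ ν k) (R : ℝ) :
    {k | ν k ≤ R}.Finite := by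
  refine (Set.Finite.pi' fun _ : Fin d => Set.finite_Icc (-⌈R⌉) ⌈R⌉).subset fun k hk i => ?_
  have h1 : |(k i : ℝ)| ≤ ⌈R⌉ := ((hν k i).trans hk).trans (Int.le_ceil R)
  rw [← Int.cast_abs] at h1
  exact Set.mem_Icc.2 (abs_le.1 (by exact_mod_cast h1))

theorem one_le_norm_of_ne_zero (hν : ∀ (k : Fin d → ℤ) (i : Fin d), |(k i : ℝ)| ≤ ν k)
    {k : Fin d → ℤ} (hk : k ≠ 0) : 1 ≤ ν k := by
  obtain ⟨i, hi⟩ := Function.ne_iff.1 hk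
  refine le_trans ?_ (hν k i)
  rw [← Int.cast_abs]
  exact_mod_cast Int.one_le_abs hi

theorem exists_mul_pow_sub_le (hν : ∀ (k : Fin d → ℤ) (i : Fin d), |(k i : ℝ)| ≤ ν k)
    {r : ℕ} {lam : (Fin d → ℤ) → ℝ} {p K L : ℝ} (hL : 0 < L) (hp : (r : ℝ) < p)
    (hlam : ∀ k, K < ν k → L * ν k ^ p ≤ lam k) {c : ℝ} (hc : 0 ≤ c) :
    ∃ l, ∀ k, c * (1 + ν k) ^ r - lam k ≤ l := by
  have hlim : Tendsto (fun x : ℝ => x ^ (p - r)) atTop atTop := tendsto_rpow_atTop (by linarith)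
  -- Beyond `R`, `c (2|k|)^r ≤ L |k|^p`; the `2^r` absorbs `1 + |k| ≤ 2|k|`, valid for `|k| ≥ 1`.
  -- Only finitely many `k` remain.
  obtain ⟨R, hR⟩ := eventually_atTop.1 (hlim.eventually_ge_atTop (c * 2 ^ r / L))
  obtain ⟨l, hl⟩ := ((finite_setOf_norm_le ν hν (max (max R K) 1)).image
    fun k => c * (1 + ν k) ^ r - lam k).bddAbove
  refine ⟨max l 0, fun k => ?_⟩
  by_cases hk : ν k ≤ max (max R K) 1
  · exact (hl (Set.mem_image_of_mem _ hk)).trans (le_max_left _ _)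
  · push Not at hk
    simp only [max_lt_iff] at hk
    obtain ⟨⟨hkR, hkK⟩, hk1⟩ := hk
    refine le_trans ?_ (le_max_right _ _)
    have hpos : 0 < ν k := by linarith
    have h1 := hR _ hkR.le
    rw [div_le_iff₀ hL] at h1
    have h2 : ν k ^ p = ν k ^ (p - r) * ν k ^ r := by
      rw [← Real.rpow_natCast (ν k) r, ← Real.rpow_add hpos]; congr 1; ring
    have h3 : (1 + ν k) ^ r ≤ (2 * ν k) ^ r := by gcongr; linarith
    have h4 := hlam k hkK
    have h5 := mul_le_mul_of_nonneg_right h1 (pow_nonneg hpos.le r)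
    have h6 := mul_le_mul_of_nonneg_left h3 hc
    rw [mul_pow] at h6
    rw [h2] at h4
    nlinarith

/-- The weight `1 + |k|` treats `k = 0` and `k ≠ 0` together; `2^s` comes from `1 + |k| ≤ 2|k|` for
`k ≠ 0`. -/
theorem norm_coef_le_of_mem_polyDecaySet {m : ℕ}
    (hν : ∀ (k : Fin d → ℤ) (i : Fin d), |(k i : ℝ)| ≤ ν k) {C s : ℝ} (hs : 0 ≤ s)
    {z : Mode d m → ℝ} (hz : z ∈ polyDecaySet ν C s) (k : Fin d → ℤ) (j : Fin m) :
    ‖coef z k j‖ ≤ C * 2 ^ s * (1 + ν k) ^ (-s) := by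
  have hC : 0 ≤ C := (norm_nonneg _).trans hz.2
  have h1 : ‖coef z k j‖ ≤ ‖WithLp.toLp 2 (coef z k)‖ :=
    PiLp.norm_apply_le (WithLp.toLp 2 (coef z k)) j
  refine h1.trans ?_
  by_cases hk : k = 0
  · subst hk
    refine hz.2.trans ?_
    have : (1 : ℝ) ≤ 2 ^ s := Real.one_le_rpow one_le_two hs
    simpa using le_mul_of_one_le_right hC this
  · refine (hz.1 k hk).trans ?_
    have hk1 := one_le_norm_of_ne_zero ν hν hk
    rw [mul_assoc, div_eq_mul_inv]
    gcongr
    rw [Real.rpow_neg (by linarith), ← div_eq_mul_inv, inv_eq_one_div,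
      div_le_div_iff₀ (by positivity) (by positivity), one_mul, ← Real.mul_rpow (by norm_num)
      (by linarith)]
    exact Real.rpow_le_rpow (by linarith) (by linarith) hs

theorem abs_apply_le_norm_coef {m : ℕ} (z : Mode d m → ℝ) (i : Mode d m) :
    |z i| ≤ ‖coef z i.1 i.2.1‖ := by
  obtain ⟨k, j, b⟩ := i
  cases b
  · exact Complex.abs_re_le_norm (coef z k j)
  · exact Complex.abs_im_le_norm (coef z k j)

theorem polyDecaySet_subset_carrier {m : ℕ}
    (hν : ∀ (k : Fin d → ℤ) (i : Fin d), |(k i : ℝ)| ≤ ν k) {C s : ℝ} (hs : (d : ℝ) < s)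
    (H : SeqSpace) : (polyDecaySet ν C s : Set (Mode d m → ℝ)) ⊆ H.carrier := by
  intro z hz
  have hs0 : 0 ≤ s := (Nat.cast_nonneg d).trans hs.le
  have h1 : Summable fun i : Mode d m => C * 2 ^ s * (1 + ν i.1) ^ (-s) := by
    have h2 := ((summable_one_add_norm_rpow ν hν hs).mul_left (C * 2 ^ s)).mul_of_nonneg
      (g := fun _ : Fin m × Bool => (1 : ℝ)) (Summable.of_finite)
      (fun k => by
        have := apply_nonneg ν k
        have hC : 0 ≤ C := (norm_nonneg _).trans hz.2
        exact mul_nonneg (by positivity) (Real.rpow_nonneg (by linarith) _))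
      (fun _ => zero_le_one)
    simpa using h2
  have h3 : Summable fun i => ‖z i‖ := h1.of_nonneg_of_le (fun _ => norm_nonneg _) fun i =>
    (abs_apply_le_norm_coef z i).trans (norm_coef_le_of_mem_polyDecaySet ν hν hs0 hz _ _)
  have h4 : Memℓp z 1 := memℓp_gen (by simpa using h3)
  cases H with
  | c0 => exact h3.of_norm.tendsto_cofinite_zero
  | l1 => exact h4
  | l2 => exact h4.of_exponent_ge (by norm_num)

end Weight

/-! ### Convolution estimates with a submultiplicative weight -/

theorem submultiplicative_sum_le {G ι : Type} [AddCommGroup G] [DecidableEq ι] {w : G → ℝ}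
    (hw : ∀ x, 1 ≤ w x) (h0 : w 0 = 1)
    (hadd : ∀ x y, w (x + y) ≤ w x * w y)
    (s : Finset ι) (κ : ι → G) :
    w (∑ i ∈ s, κ i) ≤ ∏ i ∈ s, w (κ i) := by
  induction s using Finset.induction_on with
  | empty => simp [h0]
  | insert i s hi ih =>
    rw [Finset.sum_insert hi, Finset.prod_insert hi]
    exact (hadd _ _).trans (mul_le_mul_of_nonneg_left ih (zero_le_one.trans (hw _)))

section Convolution

variable {G ι : Type} [DecidableEq G] [Fintype ι] [DecidableEq ι]

/-- Forgetting the coordinate `i₀` is injective on `A`, so the sum is part of the expansion of a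
product of `card ι - 1` sums over `T`. -/
theorem sum_prod_erase_le {T : Finset G} {A : Finset (ι → G)} {i₀ : ι} {f : G → ℝ} {M : ℝ}
    (hA : A ⊆ Fintype.piFinset fun _ => T) (hf : ∀ q, 0 ≤ f q) (hM : ∑ q ∈ T, f q ≤ M)
    (hinj : ∀ κ ∈ A, ∀ κ' ∈ A, (∀ i ≠ i₀, κ i = κ' i) → κ = κ') :
    ∑ κ ∈ A, ∏ i ∈ Finset.univ.erase i₀, f (κ i) ≤ M ^ (Fintype.card ι - 1) := by
  have h1 : ∑ κ ∈ A, ∏ i ∈ Finset.univ.erase i₀, f (κ i)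
      ≤ ∏ _i ∈ Finset.univ.erase i₀, ∑ q ∈ T, f q := by
    rw [Finset.prod_sum]
    have h2 : Set.InjOn (fun (κ : ι → G) (i : ι) (_ : i ∈ Finset.univ.erase i₀) => κ i) A :=
      fun κ hκ κ' hκ' h => hinj κ hκ κ' hκ' fun i hi =>
        congrFun (congrFun h i) (Finset.mem_erase.2 ⟨hi, Finset.mem_univ i⟩)
    have h3 : ∑ κ ∈ A, ∏ i ∈ Finset.univ.erase i₀, f (κ i)
        = ∑ p ∈ A.image (fun (κ : ι → G) (i : ι) (_ : i ∈ Finset.univ.erase i₀) => κ i),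
          ∏ x ∈ (Finset.univ.erase i₀).attach, f (p x.1 x.2) := by
      rw [Finset.sum_image h2]
      exact Finset.sum_congr rfl fun κ _ => (Finset.prod_attach _ fun i => f (κ i)).symm
    rw [h3]
    refine Finset.sum_le_sum_of_subset_of_nonneg ?_
      fun _ _ _ => Finset.prod_nonneg fun _ _ => hf _
    intro p hp
    obtain ⟨κ, hκ, rfl⟩ := Finset.mem_image.1 hp
    exact Finset.mem_pi.2 fun i _ => Fintype.mem_piFinset.1 (hA hκ) i
  refine h1.trans ?_
  rw [Finset.prod_const, Finset.card_erase_of_mem (Finset.mem_univ _), Finset.card_univ]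
  exact pow_le_pow_left₀ (Finset.sum_nonneg fun _ _ => hf _) hM _

variable [AddCommGroup G]

/-- The tuples of elements of `T` with sum `k`. -/
def tuples (ι : Type) [Fintype ι] [DecidableEq ι] (T : Finset G) (k : G) : Finset (ι → G) :=
  (Fintype.piFinset fun _ : ι => T).filter fun κ => ∑ i, κ i = k

/-- A bound for the coefficient of the unknown with index `q` in the linearization of the
`k`-th coefficient of a product of factors with coefficients bounded by `g`. -/
def linBound (ι : Type) [Fintype ι] [DecidableEq ι] (w g : G → ℝ) (r : ℕ) (T : Finset G)
    (k q : G) : ℝ :=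
  ∑ κ ∈ tuples ι T k, ∑ i₀, if κ i₀ = q then
    w q ^ r * ∏ i ∈ Finset.univ.erase i₀, g (κ i) else 0

theorem linBound_nonneg {w g : G → ℝ} (r : ℕ) (T : Finset G) (k q : G) (hw : ∀ x, 1 ≤ w x)
    (hg : ∀ x, 0 ≤ g x) : 0 ≤ linBound ι w g r T k q := by
  refine Finset.sum_nonneg fun κ _ => Finset.sum_nonneg fun i₀ _ => ?_
  split_ifs
  · exact mul_nonneg (pow_nonneg (zero_le_one.trans (hw _)) _) (Finset.prod_nonneg fun _ _ => hg _)
  · rfl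

/-- From `κ i₀ = k - ∑ κ i` over `i ≠ i₀`, `w (κ i₀) ≤ w k * ∏ w (κ i)`. Thus the derivative loss
moves to `w k ^ r` and to the other factors, whose bound becomes `w ^ r * g`. The constraint on the
sum determines `κ i₀`. -/
theorem sum_linBound_row_le {w g : G → ℝ} {r : ℕ} {T : Finset G} {M : ℝ} (hw : ∀ x, 1 ≤ w x)
    (h0 : w 0 = 1) (hneg : ∀ x, w (-x) = w x) (hadd : ∀ x y, w (x + y) ≤ w x * w y)
    (hg : ∀ x, 0 ≤ g x) (hM : ∑ q ∈ T, w q ^ r * g q ≤ M) (k : G) :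
    ∑ q ∈ T, linBound ι w g r T k q
      ≤ Fintype.card ι * M ^ (Fintype.card ι - 1) * w k ^ r := by
  have hw0 : ∀ x, 0 ≤ w x := fun x => zero_le_one.trans (hw x)
  have h1 : ∑ q ∈ T, linBound ι w g r T k q
      = ∑ i₀, ∑ κ ∈ tuples ι T k, w (κ i₀) ^ r * ∏ i ∈ Finset.univ.erase i₀, g (κ i) := by
    simp only [linBound]
    rw [Finset.sum_comm, Finset.sum_comm (s := Finset.univ)]
    refine Finset.sum_congr rfl fun κ hκ => ?_
    rw [Finset.sum_comm]
    refine Finset.sum_congr rfl fun i₀ _ => ?_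
    rw [Finset.sum_ite_eq, if_pos]
    exact Fintype.mem_piFinset.1 (Finset.mem_filter.1 hκ).1 i₀
  have h2 : ∀ i₀ : ι, ∑ κ ∈ tuples ι T k, w (κ i₀) ^ r * ∏ i ∈ Finset.univ.erase i₀, g (κ i)
      ≤ M ^ (Fintype.card ι - 1) * w k ^ r := by
    intro i₀
    have h3 : ∀ κ ∈ tuples ι T k, w (κ i₀) ^ r * ∏ i ∈ Finset.univ.erase i₀, g (κ i)
        ≤ w k ^ r * ∏ i ∈ Finset.univ.erase i₀, (w (κ i) ^ r * g (κ i)) := by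
      intro κ hκ
      have hsum : κ i₀ = k + -∑ i ∈ Finset.univ.erase i₀, κ i := by
        rw [← (Finset.mem_filter.1 hκ).2, ← Finset.add_sum_erase _ _ (Finset.mem_univ i₀)]
        abel
      have h4 : w (κ i₀) ≤ w k * ∏ i ∈ Finset.univ.erase i₀, w (κ i) := by
        calc w (κ i₀) ≤ w k * w (-∑ i ∈ Finset.univ.erase i₀, κ i) := by
              conv_lhs => rw [hsum]
              exact hadd _ _
          _ ≤ _ := by
              rw [hneg]
              exact mul_le_mul_of_nonneg_left (submultiplicative_sum_le hw h0 hadd _ _) (hw0 _)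
      rw [Finset.prod_mul_distrib, Finset.prod_pow, ← mul_assoc, ← mul_pow]
      exact mul_le_mul_of_nonneg_right (pow_le_pow_left₀ (hw0 _) h4 r)
        (Finset.prod_nonneg fun _ _ => hg _)
    refine (Finset.sum_le_sum h3).trans ?_
    rw [← Finset.mul_sum, mul_comm]
    refine mul_le_mul_of_nonneg_right ?_ (pow_nonneg (hw0 _) _)
    refine sum_prod_erase_le (f := fun q => w q ^ r * g q) (Finset.filter_subset _ _)
      (fun q => mul_nonneg (pow_nonneg (hw0 _) _) (hg _)) hM fun κ hκ κ' hκ' h => ?_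
    have e : κ i₀ = κ' i₀ := by
      have h5 : ∑ i, κ i = ∑ i, κ' i := by
        rw [(Finset.mem_filter.1 hκ).2, (Finset.mem_filter.1 hκ').2]
      rw [← Finset.add_sum_erase _ _ (Finset.mem_univ i₀),
        ← Finset.add_sum_erase _ κ' (Finset.mem_univ i₀),
        Finset.sum_congr rfl fun i hi => h i (Finset.ne_of_mem_erase hi)] at h5
      exact add_right_cancel h5
    funext i
    by_cases hi : i = i₀
    · rw [hi, e]
    · exact h i hi
  rw [h1]
  refine (Finset.sum_le_sum fun i₀ _ => h2 i₀).trans_eq ?_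
  rw [Finset.sum_const, nsmul_eq_mul, Finset.card_univ, mul_assoc]

/-- Summing over `k` releases the constraint on the sum; now `κ i₀ = q` is fixed and the other
coordinates are free, so `∑ g ≤ M` suffices. -/
theorem sum_linBound_col_le {w g : G → ℝ} {r : ℕ} {T : Finset G} {M : ℝ} (hw : ∀ x, 1 ≤ w x)
    (hg : ∀ x, 0 ≤ g x) (hM : ∑ q ∈ T, w q ^ r * g q ≤ M) (q : G) :
    ∑ k ∈ T, linBound ι w g r T k q
      ≤ Fintype.card ι * M ^ (Fintype.card ι - 1) * w q ^ r := by
  have hw0 : ∀ x, 0 ≤ w x := fun x => zero_le_one.trans (hw x)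
  have hM' : ∑ x ∈ T, g x ≤ M := (Finset.sum_le_sum fun x _ =>
    le_mul_of_one_le_left (hg x) (one_le_pow₀ (hw x))).trans hM
  set P : Finset (ι → G) := Fintype.piFinset fun _ : ι => T
  have hnn : ∀ (κ : ι → G) (i₀ : ι), 0 ≤ if κ i₀ = q then
      w q ^ r * ∏ i ∈ Finset.univ.erase i₀, g (κ i) else 0 := fun κ i₀ => by
    split_ifs
    · exact mul_nonneg (pow_nonneg (hw0 _) _) (Finset.prod_nonneg fun _ _ => hg _)
    · rfl
  have h1 : ∑ k ∈ T, linBound ι w g r T k q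
      ≤ ∑ κ ∈ P, ∑ i₀, if κ i₀ = q then
          w q ^ r * ∏ i ∈ Finset.univ.erase i₀, g (κ i) else 0 := by
    simp only [linBound, tuples]
    rw [Finset.sum_fiberwise_eq_sum_filter]
    exact Finset.sum_le_sum_of_subset_of_nonneg (Finset.filter_subset _ _)
      fun κ _ _ => Finset.sum_nonneg fun i₀ _ => hnn κ i₀
  refine h1.trans ?_
  rw [Finset.sum_comm]
  have h2 : ∀ i₀ : ι, ∑ κ ∈ P, (if κ i₀ = q then
      w q ^ r * ∏ i ∈ Finset.univ.erase i₀, g (κ i) else 0)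
      ≤ M ^ (Fintype.card ι - 1) * w q ^ r := by
    intro i₀
    rw [← Finset.sum_filter, ← Finset.mul_sum, mul_comm]
    refine mul_le_mul_of_nonneg_right ?_ (pow_nonneg (hw0 _) _)
    refine sum_prod_erase_le (Finset.filter_subset _ _) hg hM' fun κ hκ κ' hκ' h => ?_
    funext i
    by_cases hi : i = i₀
    · rw [hi, (Finset.mem_filter.1 hκ).2, (Finset.mem_filter.1 hκ').2]
    · exact h i hi
  refine (Finset.sum_le_sum fun i₀ _ => h2 i₀).trans_eq ?_
  rw [Finset.sum_const, nsmul_eq_mul, Finset.card_univ, mul_assoc]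

end Convolution

/-! ### The Jacobian of the nonlinearity -/

section Jacobian

variable {d m r : ℕ} (H : SeqSpace) (S : Finset (Mode d m))

theorem coef_eq_zero_of_notMem {a : Mode d m → ℝ} {k : Fin d → ℤ} (j : Fin m)
    (h : ∀ b, a (k, j, b) = 0) : coef a k j = 0 := by
  simp only [coef, h]
  rfl

theorem embed_of_mem {ι : Type} (H : SeqSpace) (S : Finset ι) (y : GalerkinSpace H S) {i : ι}
    (h : i ∈ S) : embed H S y i = y ⟨i, h⟩ := dif_pos h

theorem embed_of_notMem {ι : Type} (H : SeqSpace) (S : Finset ι) (y : GalerkinSpace H S) {i : ι}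
    (h : i ∉ S) : embed H S y i = 0 := dif_neg h

theorem embed_add {ι : Type} (H : SeqSpace) (S : Finset ι) (x y : GalerkinSpace H S) (i : ι) :
    embed H S (x + y) i = embed H S x i + embed H S y i := by
  by_cases h : i ∈ S
  · simp [embed_of_mem, h]
  · simp [embed_of_notMem, h]

theorem embed_smul {ι : Type} (H : SeqSpace) (S : Finset ι) (c : ℝ) (x : GalerkinSpace H S)
    (i : ι) : embed H S (c • x) i = c * embed H S x i := by
  by_cases h : i ∈ S
  · simp [embed_of_mem, h]
  · simp [embed_of_notMem, h]

theorem coef_embed_eq_zero (y : GalerkinSpace H S) {k : Fin d → ℤ} (hk : k ∉ S.image Prod.fst)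
    (j : Fin m) : coef (embed H S y) k j = 0 :=
  coef_eq_zero_of_notMem j fun _ => embed_of_notMem H S y fun h =>
    hk (Finset.mem_image_of_mem Prod.fst h)

/-- `jetCoef`, as a real linear map of the Galerkin space. -/
noncomputable def jetCLM (v : JetVar d m r) (k : Fin d → ℤ) : GalerkinSpace H S →L[ℝ] ℂ :=
  LinearMap.toContinuousLinearMap
    { toFun := fun y => jetCoef (embed H S y) v k
      map_add' := fun x y => by
        simp only [jetCoef]
        rw [← mul_add]
        congr 1
        apply Complex.ext <;> simp [coef, embed_add]
      map_smul' := fun c x => by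
        simp only [jetCoef, RingHom.id_apply, Complex.real_smul]
        rw [mul_left_comm]
        congr 1
        apply Complex.ext <;> simp [coef, embed_smul] }

theorem jetCLM_apply (v : JetVar d m r) (k : Fin d → ℤ) (y : GalerkinSpace H S) :
    jetCLM H S v k y = jetCoef (embed H S y) v k := rfl

/-- A tuple with a wave vector outside the support of the Galerkin modes has a vanishing factor. The
series is therefore finite and polynomial in `y`, which gives smoothness and the product rule. -/
theorem monomialCoef_embed (σ : JetVar d m r →₀ ℕ) (y : GalerkinSpace H S) (k : Fin d → ℤ) :
    monomialCoef σ (embed H S y) k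
      = ∑ κ ∈ tuples (Σ v : JetVar d m r, Fin (σ v)) (S.image Prod.fst) k,
          ∏ i, jetCLM H S i.1 (κ i) y := by
  have h1 := tsum_subtype {κ : (Σ v : JetVar d m r, Fin (σ v)) → (Fin d → ℤ) | ∑ i, κ i = k}
    fun κ => ∏ i, jetCoef (embed H S y) i.1 (κ i)
  refine h1.trans ?_
  rw [tsum_eq_sum (s := Fintype.piFinset fun _ => S.image Prod.fst), tuples, Finset.sum_filter]
  · refine Finset.sum_congr rfl fun κ _ => ?_
    rw [Set.indicator_apply]
    rfl
  · intro κ hκ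
    rw [Fintype.mem_piFinset] at hκ
    push Not at hκ
    obtain ⟨i, hi⟩ := hκ
    refine Set.indicator_apply_eq_zero.2 fun _ => Finset.prod_eq_zero (Finset.mem_univ i) ?_
    rw [jetCoef, coef_embed_eq_zero H S y hi, mul_zero]

theorem contDiff_monomialCoef_embed (σ : JetVar d m r →₀ ℕ) (k : Fin d → ℤ) :
    ContDiff ℝ 1 fun y : GalerkinSpace H S => monomialCoef σ (embed H S y) k := by
  simp only [monomialCoef_embed]
  exact ContDiff.sum fun κ _ => contDiff_prod fun i _ => (jetCLM H S i.1 (κ i)).contDiff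

theorem contDiff_polyCoef_embed (P : MvPolynomial (JetVar d m r) ℂ) (k : Fin d → ℤ) :
    ContDiff ℝ 1 fun y : GalerkinSpace H S => polyCoef P (embed H S y) k :=
  ContDiff.sum fun σ _ => contDiff_const.mul (contDiff_monomialCoef_embed H S σ k)

theorem norm_jetCoef_le {ν : AddGroupNorm (Fin d → ℤ)}
    (hν : ∀ (k : Fin d → ℤ) (i : Fin d), |(k i : ℝ)| ≤ ν k) (a : Mode d m → ℝ)
    (v : JetVar d m r) (k : Fin d → ℤ) :
    ‖jetCoef a v k‖ ≤ (1 + ν k) ^ r * ‖coef a k v.2‖ := by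
  have hw : 1 ≤ 1 + ν k := by have := apply_nonneg ν k; linarith
  rw [jetCoef, norm_mul, norm_prod]
  refine mul_le_mul_of_nonneg_right ?_ (norm_nonneg _)
  calc ∏ i, ‖(Complex.I * (k i : ℂ)) ^ (v.1.1 i : ℕ)‖
      ≤ ∏ i, (1 + ν k) ^ (v.1.1 i : ℕ) := by
        refine Finset.prod_le_prod (fun _ _ => norm_nonneg _) fun i _ => ?_
        rw [norm_pow, norm_mul, Complex.norm_I, one_mul, Complex.norm_intCast]
        exact pow_le_pow_left₀ (abs_nonneg _) (by linarith [hν k i]) _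
    _ = (1 + ν k) ^ (∑ i, (v.1.1 i : ℕ)) := by rw [Finset.prod_pow_eq_pow_sum]
    _ ≤ (1 + ν k) ^ r := pow_le_pow_right₀ hw v.1.2

open Classical in
/-- The unit vector of the Galerkin space in the direction of the unknown `q`. -/
noncomputable def unitVec {ι : Type} (H : SeqSpace) (S : Finset ι) (q : S) : GalerkinSpace H S :=
  WithLp.toLp _ (Pi.single q 1)

theorem norm_coef_unitVec_le (q : S) (k : Fin d → ℤ) (j : Fin m) :
    ‖coef (embed H S (unitVec H S q)) k j‖ ≤ if k = q.1.1 then 1 else 0 := by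
  classical
  have h1 : ∀ i, embed H S (unitVec H S q) i = if i = q.1 then 1 else 0 := fun i => by
    by_cases hi : i ∈ S
    · rw [embed_of_mem H S _ hi]
      simp [unitVec, Subtype.ext_iff]
    · rw [embed_of_notMem H S _ hi, if_neg]
      rintro rfl
      exact hi q.2
  obtain ⟨⟨q1, q2, b⟩, hq⟩ := q
  simp only [coef, h1, Prod.mk.injEq]
  by_cases hk : k = q1
  · cases b <;> by_cases hj : j = q2 <;> simp [hk, hj, Complex.norm_def, Complex.normSq_apply]
  · have e : (⟨0, 0⟩ : ℂ) = 0 := rfl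
    simp [hk, e]

theorem norm_fderiv_monomialCoef_le {ν : AddGroupNorm (Fin d → ℤ)}
    (hν : ∀ (k : Fin d → ℤ) (i : Fin d), |(k i : ℝ)| ≤ ν k) {g : (Fin d → ℤ) → ℝ}
    (σ : JetVar d m r →₀ ℕ) (k : Fin d → ℤ) (y : GalerkinSpace H S)
    (hy : ∀ (v : JetVar d m r) q, ‖jetCoef (embed H S y) v q‖ ≤ g q) (q : S) :
    ‖fderiv ℝ (fun y : GalerkinSpace H S => monomialCoef σ (embed H S y) k) y (unitVec H S q)‖
      ≤ linBound (Σ v : JetVar d m r, Fin (σ v)) (fun k => 1 + ν k) g r (S.image Prod.fst)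
          k q.1.1 := by
  have hd : HasFDerivAt (fun y : GalerkinSpace H S => monomialCoef σ (embed H S y) k)
      (∑ κ ∈ tuples (Σ v : JetVar d m r, Fin (σ v)) (S.image Prod.fst) k,
        ∑ i₀, (∏ i ∈ Finset.univ.erase i₀, jetCLM H S i.1 (κ i) y) • jetCLM H S i₀.1 (κ i₀)) y := by
    simp only [monomialCoef_embed]
    exact HasFDerivAt.fun_sum fun κ _ => HasFDerivAt.finsetProd fun i _ =>
      (jetCLM H S i.1 (κ i)).hasFDerivAt
  rw [hd.fderiv]
  simp only [sum_apply, smul_apply, linBound]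
  refine norm_sum_le_of_le _ fun κ _ => norm_sum_le_of_le _ fun i₀ _ => ?_
  rw [smul_eq_mul, norm_mul, norm_prod, jetCLM_apply, mul_comm]
  have h1 := (norm_jetCoef_le hν (embed H S (unitVec H S q)) i₀.1 (κ i₀))
  have h2 := norm_coef_unitVec_le H S q (κ i₀) i₀.1.2
  have h0 : 0 ≤ 1 + ν (κ i₀) := by have := apply_nonneg ν (κ i₀); linarith
  split_ifs at h2 ⊢ with hq
  · rw [← hq]
    refine mul_le_mul (h1.trans (mul_le_of_le_one_right (pow_nonneg h0 _) h2)) ?_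
      (Finset.prod_nonneg fun _ _ => norm_nonneg _) (pow_nonneg h0 _)
    exact Finset.prod_le_prod (fun _ _ => norm_nonneg _) fun i _ => hy _ _
  · rw [le_antisymm h2 (norm_nonneg _), mul_zero] at h1
    rw [le_antisymm h1 (norm_nonneg _), zero_mul]

theorem norm_fderiv_polyCoef_le {ν : AddGroupNorm (Fin d → ℤ)}
    (hν : ∀ (k : Fin d → ℤ) (i : Fin d), |(k i : ℝ)| ≤ ν k) {g : (Fin d → ℤ) → ℝ}
    (P : MvPolynomial (JetVar d m r) ℂ) (k : Fin d → ℤ) (y : GalerkinSpace H S)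
    (hy : ∀ (v : JetVar d m r) q, ‖jetCoef (embed H S y) v q‖ ≤ g q) (q : S) :
    ‖fderiv ℝ (fun y : GalerkinSpace H S => polyCoef P (embed H S y) k) y (unitVec H S q)‖
      ≤ ∑ σ ∈ P.support, ‖P.coeff σ‖ * linBound (Σ v : JetVar d m r, Fin (σ v))
          (fun k => 1 + ν k) g r (S.image Prod.fst) k q.1.1 := by
  have hd : HasFDerivAt (fun y : GalerkinSpace H S => polyCoef P (embed H S y) k)
      (∑ σ ∈ P.support, P.coeff σ • fderiv ℝ
        (fun y : GalerkinSpace H S => monomialCoef σ (embed H S y) k) y) y :=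
    HasFDerivAt.fun_sum fun σ _ => HasFDerivAt.const_mul
      ((contDiff_monomialCoef_embed H S σ k).differentiable one_ne_zero y).hasFDerivAt _
  rw [hd.fderiv]
  simp only [sum_apply, smul_apply]
  refine norm_sum_le_of_le _ fun σ _ => ?_
  rw [smul_eq_mul, norm_mul]
  exact mul_le_mul_of_nonneg_left (norm_fderiv_monomialCoef_le H S hν σ k y hy q) (norm_nonneg _)

theorem sum_comp_fst_le {f : (Fin d → ℤ) → ℝ} (hf : ∀ k, 0 ≤ f k) :
    ∑ i : S, f i.1.1 ≤ 2 * m * ∑ k ∈ S.image Prod.fst, f k := by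
  have h1 : S ⊆ S.image Prod.fst ×ˢ (Finset.univ : Finset (Fin m × Bool)) := fun i hi =>
    Finset.mem_product.2 ⟨Finset.mem_image_of_mem _ hi, Finset.mem_univ _⟩
  rw [Finset.sum_coe_sort S fun i => f i.1]
  refine (Finset.sum_le_sum_of_subset_of_nonneg h1 fun i _ _ => hf _).trans_eq ?_
  rw [Finset.sum_product, Finset.mul_sum]
  simp [mul_comm]

/-- The constant in the bounds for the row and column sums of the Jacobian of `N`. -/
noncomputable def jacobianConst (N : Fin m → MvPolynomial (JetVar d m r) ℂ) (M : ℝ) : ℝ :=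
  2 * m * ∑ j, ∑ σ ∈ (N j).support, ‖(N j).coeff σ‖ *
    (Fintype.card (Σ v : JetVar d m r, Fin (σ v)) *
      M ^ (Fintype.card (Σ v : JetVar d m r, Fin (σ v)) - 1))

theorem jacobianConst_nonneg (N : Fin m → MvPolynomial (JetVar d m r) ℂ) {M : ℝ} (hM : 0 ≤ M) :
    0 ≤ jacobianConst N M := by
  refine mul_nonneg (by positivity) (Finset.sum_nonneg fun j _ => Finset.sum_nonneg fun σ _ => ?_)
  positivity

/-- Real part for `false`, imaginary part for `true`. -/
noncomputable def partCLM : Bool → ℂ →L[ℝ] ℝ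
  | false => Complex.reCLM
  | true => Complex.imCLM

theorem abs_partCLM_le (b : Bool) (z : ℂ) : |partCLM b z| ≤ ‖z‖ := by
  cases b
  · exact Complex.abs_re_le_norm z
  · exact Complex.abs_im_le_norm z

theorem vectorField_apply (lam : (Fin d → ℤ) → ℝ) (N : Fin m → MvPolynomial (JetVar d m r) ℂ)
    (a : Mode d m → ℝ) (i : Mode d m) :
    vectorField lam N a i
      = -lam i.1 * a i + partCLM i.2.2 (polyCoef (N i.2.1) a i.1) := by
  obtain ⟨k, j, b⟩ := i
  cases b <;> simp [vectorField, partCLM, coef]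

theorem jacobian_row_col_le {ν : AddGroupNorm (Fin d → ℤ)}
    (hν : ∀ (k : Fin d → ℤ) (i : Fin d), |(k i : ℝ)| ≤ ν k) {g : (Fin d → ℤ) → ℝ}
    (hg : ∀ q, 0 ≤ g q) {M : ℝ} (hM : ∀ T : Finset (Fin d → ℤ), ∑ q ∈ T, (1 + ν q) ^ r * g q ≤ M)
    (N : Fin m → MvPolynomial (JetVar d m r) ℂ) (y : GalerkinSpace H S)
    (hy : ∀ (v : JetVar d m r) q, ‖jetCoef (embed H S y) v q‖ ≤ g q) :
    (∀ i : S, ∑ q : S, ‖fderiv ℝ (fun y : GalerkinSpace H S =>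
        polyCoef (N i.1.2.1) (embed H S y) i.1.1) y (unitVec H S q)‖
      ≤ jacobianConst N M * (1 + ν i.1.1) ^ r) ∧
    (∀ q : S, ∑ i : S, ‖fderiv ℝ (fun y : GalerkinSpace H S =>
        polyCoef (N i.1.2.1) (embed H S y) i.1.1) y (unitVec H S q)‖
      ≤ jacobianConst N M * (1 + ν q.1.1) ^ r) := by
  have hw : ∀ x, 1 ≤ 1 + ν x := fun x => by have := apply_nonneg ν x; linarith
  set B : (JetVar d m r →₀ ℕ) → (Fin d → ℤ) → (Fin d → ℤ) → ℝ := fun σ =>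
    linBound (Σ v : JetVar d m r, Fin (σ v)) (fun k => 1 + ν k) g r (S.image Prod.fst) with hB
  have hB0 : ∀ σ k q, 0 ≤ B σ k q := fun σ k q => linBound_nonneg r _ k q hw hg
  have hrow : ∀ σ k, ∑ q ∈ S.image Prod.fst, B σ k q ≤ _ := fun σ k =>
    sum_linBound_row_le (w := fun k => 1 + ν k) hw (by simp) (by simp)
      (fun x y => by
        have h1 := map_add_le_add ν x y
        have h2 := mul_nonneg (apply_nonneg ν x) (apply_nonneg ν y)
        linarith) hg (hM _) k
  have hcol : ∀ σ q, ∑ k ∈ S.image Prod.fst, B σ k q ≤ _ := fun σ q =>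
    sum_linBound_col_le (w := fun k => 1 + ν k) hw hg (hM _) q
  -- Summing over all components `j` makes the entry bound depend on the wave vectors only, so each
  -- sum over `S` costs a factor `2m`.
  set E : (Fin d → ℤ) → (Fin d → ℤ) → ℝ := fun k q =>
    ∑ j, ∑ σ ∈ (N j).support, ‖(N j).coeff σ‖ * B σ k q with hE
  have hE0 : ∀ k q, 0 ≤ E k q := fun k q => Finset.sum_nonneg fun j _ =>
    Finset.sum_nonneg fun σ _ => mul_nonneg (norm_nonneg _) (hB0 _ _ _)
  have hentry : ∀ i q : S, ‖fderiv ℝ (fun y : GalerkinSpace H S =>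
      polyCoef (N i.1.2.1) (embed H S y) i.1.1) y (unitVec H S q)‖ ≤ E i.1.1 q.1.1 := fun i q =>
    (norm_fderiv_polyCoef_le H S hν (N i.1.2.1) i.1.1 y hy q).trans
      (Finset.single_le_sum (f := fun j => ∑ σ ∈ (N j).support, ‖(N j).coeff σ‖ * B σ i.1.1 q.1.1)
        (fun j _ => Finset.sum_nonneg fun σ _ => mul_nonneg (norm_nonneg _) (hB0 _ _ _))
        (Finset.mem_univ i.1.2.1))
  constructor
  · intro i
    refine (Finset.sum_le_sum fun q _ => hentry i q).trans
      ((sum_comp_fst_le S (hE0 i.1.1)).trans ?_)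
    rw [jacobianConst, mul_assoc (2 * (m : ℝ))]
    refine mul_le_mul_of_nonneg_left ?_ (by positivity)
    rw [hE, Finset.sum_comm, Finset.sum_mul]
    refine Finset.sum_le_sum fun j _ => ?_
    rw [Finset.sum_comm, Finset.sum_mul]
    refine Finset.sum_le_sum fun σ _ => ?_
    rw [← Finset.mul_sum, mul_assoc]
    exact mul_le_mul_of_nonneg_left (hrow σ _) (norm_nonneg _)
  · intro q
    refine (Finset.sum_le_sum fun i _ => hentry i q).trans
      ((sum_comp_fst_le S (f := fun k => E k q.1.1) fun k => hE0 k _).trans ?_)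
    rw [jacobianConst, mul_assoc (2 * (m : ℝ))]
    refine mul_le_mul_of_nonneg_left ?_ (by positivity)
    rw [hE, Finset.sum_comm, Finset.sum_mul]
    refine Finset.sum_le_sum fun j _ => ?_
    rw [Finset.sum_comm, Finset.sum_mul]
    refine Finset.sum_le_sum fun σ _ => ?_
    rw [← Finset.mul_sum, mul_assoc]
    exact mul_le_mul_of_nonneg_left (hcol σ _) (norm_nonneg _)

end Jacobian

/-! ### The Galerkin vector field and its logarithmic norm -/

section Galerkin

variable {d m r : ℕ} (H : SeqSpace) (S : Finset (Mode d m))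

/-- The set `S` may separate real and imaginary parts, but deleting either one only decreases the
modulus, so decay bounds survive projection. -/
theorem norm_coef_embed_proj_le (z : Mode d m → ℝ) (k : Fin d → ℤ) (j : Fin m) :
    ‖coef (embed H S (proj H S z)) k j‖ ≤ ‖coef z k j‖ := by
  have h1 : ∀ i, embed H S (proj H S z) i * embed H S (proj H S z) i ≤ z i * z i := fun i => by
    by_cases hi : i ∈ S
    · rw [embed_of_mem H S _ hi]
      rfl
    · rw [embed_of_notMem H S _ hi, mul_zero]
      exact mul_self_nonneg _
  simp only [Complex.norm_def, Complex.normSq_apply]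
  exact Real.sqrt_le_sqrt (add_le_add (h1 _) (h1 _))

theorem galerkin_vectorField_apply (lam : (Fin d → ℤ) → ℝ)
    (N : Fin m → MvPolynomial (JetVar d m r) ℂ) (y : GalerkinSpace H S) (i : S) :
    galerkin H S (vectorField lam N) y i
      = -lam i.1.1 * y i + partCLM i.1.2.2 (polyCoef (N i.1.2.1) (embed H S y) i.1.1) := by
  change vectorField lam N (embed H S y) i.1 = _
  rw [vectorField_apply, embed_of_mem H S y i.2]

theorem contDiff_galerkin_vectorField (lam : (Fin d → ℤ) → ℝ)
    (N : Fin m → MvPolynomial (JetVar d m r) ℂ) :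
    ContDiff ℝ 1 (galerkin H S (vectorField lam N)) := by
  refine contDiff_piLp' _ fun i => ?_
  simp only [galerkin_vectorField_apply]
  exact (contDiff_const.mul (PiLp.proj (𝕜 := ℝ) H.exponent (fun _ : S => ℝ) i).contDiff).add
    ((partCLM i.1.2.2).contDiff.comp (contDiff_polyCoef_embed H S _ _))

theorem fderiv_galerkin_vectorField_apply (lam : (Fin d → ℤ) → ℝ)
    (N : Fin m → MvPolynomial (JetVar d m r) ℂ) (y x : GalerkinSpace H S) (i : S) :
    fderiv ℝ (galerkin H S (vectorField lam N)) y x i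
      = -lam i.1.1 * x i + partCLM i.1.2.2 (fderiv ℝ (fun y : GalerkinSpace H S =>
          polyCoef (N i.1.2.1) (embed H S y) i.1.1) y x) := by
  have h1 : HasFDerivAt (fun y => galerkin H S (vectorField lam N) y i)
      ((PiLp.proj (𝕜 := ℝ) H.exponent (fun _ : S => ℝ) i).comp
        (fderiv ℝ (galerkin H S (vectorField lam N)) y)) y :=
    (PiLp.proj (𝕜 := ℝ) H.exponent (fun _ : S => ℝ) i).hasFDerivAt.comp y
      ((contDiff_galerkin_vectorField H S lam N).differentiable one_ne_zero y).hasFDerivAt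
  have h2 : HasFDerivAt (fun y => galerkin H S (vectorField lam N) y i)
      (-lam i.1.1 • PiLp.proj (𝕜 := ℝ) H.exponent (fun _ : S => ℝ) i
        + (partCLM i.1.2.2).comp (fderiv ℝ (fun y : GalerkinSpace H S =>
          polyCoef (N i.1.2.1) (embed H S y) i.1.1) y)) y := by
    simp only [galerkin_vectorField_apply]
    exact ((PiLp.proj (𝕜 := ℝ) H.exponent (fun _ : S => ℝ) i).hasFDerivAt.const_mul _).add
      ((partCLM i.1.2.2).hasFDerivAt.comp y
        ((contDiff_polyCoef_embed H S _ _).differentiable one_ne_zero y).hasFDerivAt)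
  have h3 := congrArg (fun L : GalerkinSpace H S →L[ℝ] ℝ => L x) (h1.unique h2)
  simpa using h3

theorem eq_sum_smul_unitVec {ι : Type} (H : SeqSpace) (S : Finset ι) (x : GalerkinSpace H S) :
    x = ∑ q, x q • unitVec H S q := by
  classical
  ext i
  simp [unitVec, Pi.single_apply, WithLp.ofLp_sum]

theorem norm_id_add_smul_le {lam : (Fin d → ℤ) → ℝ} {N : Fin m → MvPolynomial (JetVar d m r) ℂ}
    {ν : AddGroupNorm (Fin d → ℤ)} (y : GalerkinSpace H S) {c l : ℝ}
    (hl : ∀ k, c * (1 + ν k) ^ r - lam k ≤ l)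
    (hrow : ∀ i : S, ∑ q : S, ‖fderiv ℝ (fun y : GalerkinSpace H S =>
        polyCoef (N i.1.2.1) (embed H S y) i.1.1) y (unitVec H S q)‖ ≤ c * (1 + ν i.1.1) ^ r)
    (hcol : ∀ q : S, ∑ i : S, ‖fderiv ℝ (fun y : GalerkinSpace H S =>
        polyCoef (N i.1.2.1) (embed H S y) i.1.1) y (unitVec H S q)‖ ≤ c * (1 + ν q.1.1) ^ r)
    (hS : S.Nonempty) {h : ℝ} (hh : 0 < h) (hlam : ∀ i : S, h * lam i.1.1 ≤ 1) :
    ‖ContinuousLinearMap.id ℝ (GalerkinSpace H S)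
      + h • fderiv ℝ (galerkin H S (vectorField lam N)) y‖ ≤ 1 + h * l := by
  classical
  set Φ : S → S → ℂ := fun i q => fderiv ℝ (fun y : GalerkinSpace H S =>
        polyCoef (N i.1.2.1) (embed H S y) i.1.1) y (unitVec H S q) with hΦ
  -- The matrix of `I + hA`. As `h λ_i ≤ 1`, the diagonal part `1 - h λ_i` is nonnegative and keeps
  -- its sign under absolute values, so the damping is not lost.
  set e : S → S → ℝ := fun i q =>
    (if q = i then 1 - h * lam i.1.1 else 0) + h * partCLM i.1.2.2 (Φ i q) with he
  have habs : ∀ i q, |e i q| ≤ (if q = i then 1 - h * lam i.1.1 else 0) + h * ‖Φ i q‖ := by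
    intro i q
    refine (abs_add_le _ _).trans (add_le_add ?_ ?_)
    · split_ifs
      · exact (abs_of_nonneg (by linarith [hlam i])).le
      · simp
    · rw [abs_mul, abs_of_pos hh]
      exact mul_le_mul_of_nonneg_left (abs_partCLM_le _ _) hh.le
  have hrow' : ∀ i, ∑ q, |e i q| ≤ 1 + h * l := fun i => by
    refine (Finset.sum_le_sum fun q _ => habs i q).trans ?_
    rw [Finset.sum_add_distrib, ← Finset.mul_sum, Finset.sum_ite_eq', if_pos (Finset.mem_univ _)]
    have h1 := mul_le_mul_of_nonneg_left ((hrow i).trans (by linarith [hl i.1.1] :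
      _ ≤ l + lam i.1.1)) hh.le
    rw [mul_add] at h1
    linarith
  have hcol' : ∀ q, ∑ i, |e i q| ≤ 1 + h * l := fun q => by
    refine (Finset.sum_le_sum fun i _ => habs i q).trans ?_
    rw [Finset.sum_add_distrib, ← Finset.mul_sum, Finset.sum_ite_eq, if_pos (Finset.mem_univ _)]
    have h1 := mul_le_mul_of_nonneg_left ((hcol q).trans (by linarith [hl q.1.1] :
      _ ≤ l + lam q.1.1)) hh.le
    rw [mul_add] at h1
    linarith
  refine norm_le_of_row_col_sums H _ e (fun x i => ?_) ?_ hrow' hcol'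
  · have h1 : fderiv ℝ (fun y : GalerkinSpace H S =>
        polyCoef (N i.1.2.1) (embed H S y) i.1.1) y x = ∑ q, x q • Φ i q := by
      conv_lhs => rw [eq_sum_smul_unitVec H S x]
      simp [hΦ]
    have h2 : (ContinuousLinearMap.id ℝ (GalerkinSpace H S)
        + h • fderiv ℝ (galerkin H S (vectorField lam N)) y) x i
        = x i + h * fderiv ℝ (galerkin H S (vectorField lam N)) y x i := rfl
    rw [h2, fderiv_galerkin_vectorField_apply, h1, map_sum]
    simp only [he, add_mul, Finset.sum_add_distrib, ite_mul, zero_mul, Finset.sum_ite_eq',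
      Finset.mem_univ, if_true, map_smul, smul_eq_mul, mul_add, Finset.mul_sum]
    have h3 : ∀ q, h * partCLM i.1.2.2 (Φ i q) * x q = h * (x q * partCLM i.1.2.2 (Φ i q)) :=
      fun q => by ring
    simp only [h3]
    ring
  -- The constant `1 + h * l` is nonnegative because it bounds some row sum.
  · obtain ⟨i, hi⟩ := hS
    exact (Finset.sum_nonneg fun _ _ => abs_nonneg _).trans (hrow' ⟨i, hi⟩)

theorem nontrivial_galerkinSpace {ι : Type} (H : SeqSpace) {S : Finset ι} (hS : S.Nonempty) :
    Nontrivial (GalerkinSpace H S) := by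
  classical
  obtain ⟨i, hi⟩ := hS
  refine ⟨unitVec H S ⟨i, hi⟩, 0, fun h => ?_⟩
  have h1 := congrArg (fun x : GalerkinSpace H S => x ⟨i, hi⟩) h
  simp [unitVec] at h1

end Galerkin

end TorusPDE

/-! ### Uniform constants and conclusion -/

theorem mainTheorem4 (d m r : ℕ)
    (ν : AddGroupNorm (Fin d → ℤ)) (hν : ∀ (k : Fin d → ℤ) (i : Fin d), |(k i : ℝ)| ≤ ν k)
    (N : Fin m → MvPolynomial (TorusPDE.JetVar d m r) ℂ)
    (lam : (Fin d → ℤ) → ℝ) (p K Llow Lup : ℝ) (hLlow : 0 < Llow) (hp : (r : ℝ) < p)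
    (hlam : ∀ k : Fin d → ℤ, K < ν k → Llow * ν k ^ p ≤ lam k ∧ lam k ≤ Lup * ν k ^ p)
    (C s : ℝ) (hs : 2 * (r : ℝ) + d < s)
    (H : TorusPDE.SeqSpace) (J : TorusPDE.GalerkinFiltration (TorusPDE.Mode d m)) :
    TorusPDE.ConditionC2 H J (TorusPDE.vectorField lam N) (TorusPDE.polyDecaySet ν C s) := by
  open TorusPDE in
  have hr0 : (0 : ℝ) ≤ r := Nat.cast_nonneg r
  have hd0 : (0 : ℝ) ≤ d := Nat.cast_nonneg d
  have hw : ∀ k, 0 < 1 + ν k := fun k => by have := apply_nonneg ν k; linarith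
  refine ⟨polyDecaySet_subset_carrier ν hν (by linarith) H,
    fun n => contDiff_galerkin_vectorField H (J.sets n) lam N, ?_⟩
  -- The absolute value keeps `D ≥ 0` even when `C < 0` and the set is empty.
  set D : ℝ := |C| * 2 ^ s with hD
  have hD0 : 0 ≤ D := by positivity
  set g : (Fin d → ℤ) → ℝ := fun q => (1 + ν q) ^ r * (D * (1 + ν q) ^ (-s)) with hg
  have hg0 : ∀ q, 0 ≤ g q := fun q =>
    mul_nonneg (pow_nonneg (hw q).le _) (mul_nonneg hD0 (Real.rpow_nonneg (hw q).le _))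
  have hsum : Summable fun q => (1 + ν q) ^ r * g q := by
    refine ((summable_one_add_norm_rpow ν hν (t := s - 2 * r) (by linarith)).mul_left D).congr
      fun q => ?_
    have h1 : (1 + ν q) ^ (-(s - 2 * r)) = (1 + ν q) ^ (-s) * ((1 + ν q) ^ r * (1 + ν q) ^ r) := by
      rw [← Real.rpow_natCast, ← Real.rpow_add (hw q), ← Real.rpow_add (hw q)]
      congr 1
      ring
    rw [h1]
    simp only [hg]
    ring
  have hnn : ∀ q, 0 ≤ (1 + ν q) ^ r * g q := fun q =>
    mul_nonneg (pow_nonneg (hw q).le _) (hg0 q)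
  set M : ℝ := ∑' q, (1 + ν q) ^ r * g q
  have hM : ∀ T : Finset (Fin d → ℤ), ∑ q ∈ T, (1 + ν q) ^ r * g q ≤ M := fun T =>
    hsum.sum_le_tsum T fun q _ => hnn q
  -- `l` is fixed before `n` and `z`: `M` is a sum over the whole lattice.
  obtain ⟨l, hl⟩ := exists_mul_pow_sub_le ν hν hLlow hp (fun k hk => (hlam k hk).1)
    (jacobianConst_nonneg N (tsum_nonneg hnn : 0 ≤ M))
  refine ⟨l, fun n z hz => ?_⟩
  have hjet : ∀ (v : JetVar d m r) q,
      ‖jetCoef (embed H (J.sets n) (proj H (J.sets n) z)) v q‖ ≤ g q := fun v q => by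
    refine (norm_jetCoef_le hν _ v q).trans
      (mul_le_mul_of_nonneg_left ?_ (pow_nonneg (hw q).le _))
    refine (norm_coef_embed_proj_le H (J.sets n) z q v.2).trans
      ((norm_coef_le_of_mem_polyDecaySet ν hν (by linarith) hz q v.2).trans ?_)
    refine mul_le_mul_of_nonneg_right ?_ (Real.rpow_nonneg (hw q).le _)
    exact mul_le_mul_of_nonneg_right (le_abs_self C) (by positivity)
  obtain ⟨hrow, hcol⟩ := jacobian_row_col_le H (J.sets n) hν hg0 hM N _ hjet
  have := nontrivial_galerkinSpace H (J.nonempty n)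
  refine exists_isLogNorm_le _ l ?_
  -- The admissible range of `h` may shrink with `n`; this is harmless, as only the limit `h → 0+`
  -- matters.
  have hsmall : ∀ᶠ h in 𝓝[>] (0 : ℝ), ∀ i : J.sets n, h * lam i.1.1 ≤ 1 := by
    refine eventually_all.2 fun i => nhdsWithin_le_nhds ?_
    have h1 : Tendsto (fun h : ℝ => h * lam i.1.1) (𝓝 0) (𝓝 0) := by
      simpa using (continuous_mul_const (lam i.1.1)).tendsto 0
    exact h1.eventually_le_const one_pos
  filter_upwards [hsmall, self_mem_nhdsWithin] with h h1 h2
  exact norm_id_add_smul_le H (J.sets n) _ hl hrow hcol (J.nonempty n) h2 h1
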